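/- Let $R$ be a ring (associative, unital) and let $N\in\mathbb{N}$. Let $\mathrm{C}_N(\mathrm{Mod}_R)$ be the category of $N$-complexes of $R$-modules, i.e. of sequences $\cdots\to X^{i}\xrightarrow{d}X^{i+1}\to\cdots$ $(i\in\mathbb{Z})$ with $d^N=0$, with the morphisms commuting with $d$. Let $\mathcal{S}_\oplus$ be the class of levelwise split short exact sequences in $\mathrm{C}_N(\mathrm{Mod}_R)$; it is a Frobenius exact structure. Let $\mathrm{K}_N(\mathrm{Mod}_R)$ be the corresponding stable category: its objects are the $N$-complexes, and its morphisms are the morphisms of $N$-complexes modulo those that factor through an object which is both $\mathcal{S}_\oplus$-injective and $\mathcal{S}_\oplus$-projective. It is triangulated, the distinguished triangles being those isomorphic to a triangle induced by a sequence in $\mathcal{S}_\oplus$. For $1\le r\le N-1$ and $i\in\mathbb{Z}$ put $H^i_{(r)}(X)=\ker(d^r\colon X^i\to X^{i+r})/\mathrm{im}(d^{N-r}\colon X^{i-N+r}\to X^i)$. An $N$-complex $X$ is called acyclic if $H^i_{(r)}(X)=0$ for all such $r$ and $i$; let $\mathrm{K}_N(\mathrm{Mod}_R)^{\emptyset}\subseteq\mathrm{K}_N(\mathrm{Mod}_R)$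 be the full subcategory of acyclic objects. The derived category is the Verdier quotient $\mathrm{D}_N(\mathrm{Mod}_R)=\mathrm{K}_N(\mathrm{Mod}_R)/\mathrm{K}_N(\mathrm{Mod}_R)^{\emptyset}$, i.e. the localization of $\mathrm{K}_N(\mathrm{Mod}_R)$ at the morphisms with acyclic cone, with canonical functor $\pi\colon\mathrm{K}_N(\mathrm{Mod}_R)\to\mathrm{D}_N(\mathrm{Mod}_R)$. An $N$-complex $X$ is called h-projective if $\mathrm{K}_N(\mathrm{Mod}_R)(X,Y)=0$ for every acyclic $Y$; let $\mathrm{h\text{-}proj}_N(\mathrm{Mod}_R)\subseteq\mathrm{K}_N(\mathrm{Mod}_R)$ be the full subcategory of h-projective objects. Then the restriction of $\pi$ to $\mathrm{h\text{-}proj}_N(\mathrm{Mod}_R)$ is an equivalence of categories $$\mathrm{h\text{-}proj}_N(\mathrm{Mod}_R)\xrightarrow{\ \sim\ }\mathrm{D}_N(\mathrm{Mod}_R).$$ -/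

import Mathlib

open CategoryTheory CategoryTheory.Limits

universe v u

noncomputable section

namespace NComplex

/-! ### The category of `N`-complexes

The category of sequences `⋯ ⟶ X^i ⟶ X^(i+1) ⟶ ⋯` in `A` (without any condition on the
differential) is the category of functors from the poset `ℤ` to `A`. Under this identification
the `r`-fold differential `d^r : X^i ⟶ X^(i+r)` is the image of the inequality `i ≤ i + r`. -/

section Complexes

variable (A : Type u) [Category.{v} A]

/-- A sequence `X` is an `N`-complex if `d^N = 0`. -/
def IsNComplex [HasZeroMorphisms A] (N : ℕ) : ObjectProperty (ℤ ⥤ A) :=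
  fun X => ∀ i : ℤ, X.map (homOfLE (by lia : i ≤ i + N)) = 0

/-- The category `C_N(A)` of `N`-complexes in `A`: the full subcategory of the category of
sequences on the `N`-complexes. -/
abbrev CN [HasZeroMorphisms A] (N : ℕ) := (IsNComplex A N).FullSubcategory

variable {A}

/-- The differential iterated: the map `X^i ⟶ X^j` for `i ≤ j`, i.e. `d^(j - i)`. -/
abbrev dPow [HasZeroMorphisms A] {N : ℕ} (X : CN A N) {i j : ℤ} (h : i ≤ j) :
    X.obj.obj i ⟶ X.obj.obj j :=
  X.obj.map (homOfLE h)

lemma dPow_eq_zero [HasZeroMorphisms A] {N : ℕ} (X : CN A N) {i j : ℤ} (h : j = i + N) :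
    dPow X (show i ≤ j by lia) = 0 := by
  subst h
  exact X.property i

variable (A)

/-- The functor `X ↦ X^n`. -/
abbrev level [HasZeroMorphisms A] (N : ℕ) (n : ℤ) : CN A N ⥤ A :=
  (IsNComplex A N).ι ⋙ (evaluation ℤ A).obj n

instance [HasZeroMorphisms A] [HasBinaryProducts A] (N : ℕ) :
    (IsNComplex A N).IsClosedUnderBinaryProducts where
  limitsOfShape_le := by
    rintro X ⟨p⟩ i
    have hl := isLimitOfPreserves ((evaluation ℤ A).obj (i + N)) p.isLimit
    refine hl.hom_ext fun j => ?_
    have h1 := p.prop_diag_obj j i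
    have h2 := (p.π.app j).naturality (homOfLE (by lia : i ≤ i + N))
    dsimp at h1 h2 ⊢
    rw [h2, h1]
    simp

instance [Preadditive A] [HasFiniteBiproducts A] (N : ℕ) : HasBinaryBiproducts (CN A N) :=
  HasBinaryBiproducts.of_hasBinaryProducts

end Complexes

/-! ### The Frobenius exact structure and the homotopy category -/

section Stable

variable {A : Type u} [Category.{v} A] [Preadditive A] {N : ℕ}

/-- The class `S_⊕` of levelwise split short exact sequences of `N`-complexes. -/
def LevelwiseSplit (S : ShortComplex (CN A N)) : Prop :=
  ∀ n : ℤ, Nonempty (S.map (level A N n)).Splitting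

/-- `S_⊕`-injective objects. -/
def IsSplitInjective (P : CN A N) : Prop :=
  ∀ S : ShortComplex (CN A N), LevelwiseSplit S →
    ∀ a : S.X₁ ⟶ P, ∃ b : S.X₂ ⟶ P, S.f ≫ b = a

/-- `S_⊕`-projective objects. -/
def IsSplitProjective (P : CN A N) : Prop :=
  ∀ S : ShortComplex (CN A N), LevelwiseSplit S →
    ∀ a : P ⟶ S.X₃, ∃ b : P ⟶ S.X₂, b ≫ S.g = a

/-- The morphism `f` factors through an object which is both `S_⊕`-injective and
`S_⊕`-projective. -/
def FactorsThroughInjProj {X Y : CN A N} (f : X ⟶ Y) : Prop :=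
  ∃ (P : CN A N) (a : X ⟶ P) (b : P ⟶ Y),
    IsSplitInjective P ∧ IsSplitProjective P ∧ a ≫ b = f

lemma FactorsThroughInjProj.comp_left {X Y Z : CN A N} (g : X ⟶ Y) {f : Y ⟶ Z}
    (hf : FactorsThroughInjProj f) : FactorsThroughInjProj (g ≫ f) := by
  obtain ⟨P, a, b, h1, h2, rfl⟩ := hf
  exact ⟨P, g ≫ a, b, h1, h2, by simp⟩

lemma FactorsThroughInjProj.comp_right {X Y Z : CN A N} {f : X ⟶ Y} (g : Y ⟶ Z)
    (hf : FactorsThroughInjProj f) : FactorsThroughInjProj (f ≫ g) := by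
  obtain ⟨P, a, b, h1, h2, rfl⟩ := hf
  exact ⟨P, a, b ≫ g, h1, h2, by simp⟩

lemma FactorsThroughInjProj.neg {X Y : CN A N} {f : X ⟶ Y}
    (hf : FactorsThroughInjProj f) : FactorsThroughInjProj (-f) := by
  obtain ⟨P, a, b, h1, h2, rfl⟩ := hf
  exact ⟨P, a, -b, h1, h2, by simp⟩

variable [HasFiniteBiproducts A]

lemma FactorsThroughInjProj.zero (X Y : CN A N) :
    FactorsThroughInjProj (0 : X ⟶ Y) := by
  let Z : CN A N := ⟨(Functor.const ℤ).obj (biproduct (fun i : Fin 0 => i.elim0)), fun _ => by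
    apply biproduct.hom_ext
    rintro ⟨_, h⟩
    simp at h⟩
  have hZ : IsZero Z := by
    rw [IsZero.iff_id_eq_zero]
    apply ObjectProperty.hom_ext
    ext n
    apply biproduct.hom_ext
    rintro ⟨_, h⟩
    simp at h
  exact ⟨Z, 0, 0, fun S _ a => ⟨0, hZ.eq_of_tgt _ _⟩, fun S _ a => ⟨0, hZ.eq_of_src _ _⟩,
    by simp⟩

lemma FactorsThroughInjProj.add {X Y : CN A N} {f g : X ⟶ Y}
    (hf : FactorsThroughInjProj f) (hg : FactorsThroughInjProj g) :
    FactorsThroughInjProj (f + g) := by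
  obtain ⟨P, a, b, h1, h2, rfl⟩ := hf
  obtain ⟨Q, c, d, h3, h4, rfl⟩ := hg
  refine ⟨P ⊞ Q, biprod.lift a c, biprod.desc b d, fun S hS e => ?_, fun S hS e => ?_, by simp⟩
  · obtain ⟨x, hx⟩ := h1 S hS (e ≫ biprod.fst)
    obtain ⟨y, hy⟩ := h3 S hS (e ≫ biprod.snd)
    exact ⟨biprod.lift x y, by apply biprod.hom_ext <;> simp [hx, hy]⟩
  · obtain ⟨x, hx⟩ := h2 S hS (biprod.inl ≫ e)
    obtain ⟨y, hy⟩ := h4 S hS (biprod.inr ≫ e)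
    exact ⟨biprod.desc x y, by apply biprod.hom_ext' <;> simp [hx, hy]⟩

end Stable

section Homotopy

variable (A : Type u) [Category.{v} A] [Preadditive A] (N : ℕ)

/-- Two morphisms of `N`-complexes are identified in the stable category when their difference
factors through an `S_⊕`-injective-projective object. -/
def stableRel : HomRel (CN A N) := fun _ _ f g => FactorsThroughInjProj (f - g)

variable [HasFiniteBiproducts A]

instance : Congruence (stableRel A N) where
  equivalence :=
    { refl := fun f => by simpa [stableRel] using FactorsThroughInjProj.zero _ _
      symm := fun h => by simpa [stableRel] using FactorsThroughInjProj.neg h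
      trans := fun h h' => by simpa [stableRel] using FactorsThroughInjProj.add h h' }
  comp_left := fun f _ _ h => by
    simpa [stableRel, Preadditive.comp_sub] using FactorsThroughInjProj.comp_left f h
  comp_right := fun g h => by
    simpa [stableRel, Preadditive.sub_comp] using FactorsThroughInjProj.comp_right g h

/-- The homotopy category `K_N(A)`: the stable category of `C_N(A)` with respect to `S_⊕`. -/
def KN := CategoryTheory.Quotient (stableRel A N)

instance : Category (KN A N) :=
  inferInstanceAs <| Category (CategoryTheory.Quotient (stableRel A N))

instance : Preadditive (CategoryTheory.Quotient (stableRel A N)) :=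
  Quotient.preadditive _ (by
    intro X Y f₁ f₂ g₁ g₂ h h'
    have := FactorsThroughInjProj.add h h'
    rwa [show f₁ - f₂ + (g₁ - g₂) = (f₁ + g₁) - (f₂ + g₂) by abel] at this)

instance : Preadditive (KN A N) :=
  inferInstanceAs <| Preadditive (CategoryTheory.Quotient (stableRel A N))

/-- The canonical functor `C_N(A) ⥤ K_N(A)`. -/
def KN.quotient : CN A N ⥤ KN A N := CategoryTheory.Quotient.functor (stableRel A N)

variable {A N}

/-- `Z` is a cone of the morphism `f` of `K_N(A)`, i.e. the third object of a distinguished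
triangle `X ⟶ Y ⟶ Z ⟶ ΣX` starting with `f`. The distinguished triangles of the stable category
are those isomorphic to a triangle induced by a sequence in `S_⊕`. -/
def IsConeOf {X Y : KN A N} (f : X ⟶ Y) (Z : KN A N) : Prop :=
  ∃ S : ShortComplex (CN A N), LevelwiseSplit S ∧
    Nonempty (Arrow.mk f ≅ Arrow.mk ((KN.quotient A N).map S.f)) ∧
    Nonempty (Z ≅ (KN.quotient A N).obj S.X₃)

end Homotopy

/-! ### Cohomology and the derived category -/

section Derived

attribute [instance] Abelian.hasFiniteBiproducts

variable {A : Type u} [Category.{v} A] [Abelian A] {N : ℕ}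

/-- The sequence `X^(i-(N-r)) ⟶ X^i ⟶ X^(i+r)` with maps `d^(N-r)` and `d^r`. -/
def cohomologySequence (X : CN A N) (r : ℕ) (hr : r ≤ N) (i : ℤ) : ShortComplex A where
  X₁ := X.obj.obj (i - (N - r))
  X₂ := X.obj.obj i
  X₃ := X.obj.obj (i + r)
  f := dPow X (by lia)
  g := dPow X (by lia)
  zero := by
    rw [← Functor.map_comp]
    exact dPow_eq_zero X (by lia)

/-- The cohomology `H^i_(r)(X) = ker(d^r)^i / im(d^(N-r))^i`. -/
def cohomology (X : CN A N) (r : ℕ) (hr : r ≤ N) (i : ℤ) : A :=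
  (cohomologySequence X r hr i).homology

variable (A N)

/-- The acyclic objects of `K_N(A)`: those with `H^i_(r) = 0` for all `i ∈ ℤ` and
`1 ≤ r ≤ N - 1`. -/
def acyclic : ObjectProperty (KN A N) :=
  fun X => ∀ (r : ℕ) (_ : 1 ≤ r) (hr : r < N) (i : ℤ), IsZero (cohomology X.as r hr.le i)

/-- The morphisms of `K_N(A)` which have an acyclic cone. -/
def acyclicCone : MorphismProperty (KN A N) :=
  fun _ _ f => ∃ Z, IsConeOf f Z ∧ acyclic A N Z

/-- The derived category `D_N(A)`: the Verdier quotient of `K_N(A)` by the acyclic objects, i.e.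
the localization of `K_N(A)` at the morphisms which have an acyclic cone. -/
abbrev DN := (acyclicCone A N).Localization

/-- The canonical functor `π : K_N(A) ⥤ D_N(A)`. -/
abbrev DN.π : KN A N ⥤ DN A N := (acyclicCone A N).Q

/-- The h-projective objects of `K_N(A)`: those `X` such that the group `K_N(A)(X, Y)` is trivial
for every acyclic `Y`. -/
def hproj : ObjectProperty (KN A N) :=
  fun X => ∀ Y : KN A N, acyclic A N Y → ∀ f : X ⟶ Y, f = 0

end Derived

end NComplex

end

/-! The argument is a Bousfield colocalization. Suppose every object `X` receives a morphism `Y ⟶ X`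
in `W` with `Y` in `P`, and `W`-morphisms induce bijections on maps out of objects of `P`. Then `P`
is coreflective, the coreflector inverts `W`, the counit lies in `W`, and `P` is the localization
(`isEquivalence_ι_comp_Q`). For `P` the h-projectives and `W` the morphisms with acyclic cone, two
inputs are needed.

Colocality (`acyclicCone_le_isColocal`) is the long exact Hom sequence of a triangle, carried out by
hand on a levelwise split sequence. The disks, sums of `M a` placed in `N` consecutive degrees with
identity differentials, supply enough projective-injectives and play the role of contractible
complexes.

Resolutions (`exists_cofibrant_resolution`) come from the small object argument for sphere-to-disk
inclusions in the category of all sequences `ℤ ⥤ Mod_R`, applied to `0 ⟶ X`. The resulting cofibrant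
sequence turns out to satisfy `d^N = 0`. It is h-projective because a map to an acyclic `Y` lifts
through a disk cover of `Y` (`hproj_of_llp`). The trivial fibration onto `X` has acyclic cone
(`acyclicCone_of_rlp`). -/

noncomputable section

namespace NComplex

/-! ### Coreflective subcategories as localizations -/

section Coreflection

variable {C : Type*} [Category* C]

/-- If a class `W` of morphisms is colocal for `P` and every object admits a morphism in `W` from
an object satisfying `P`, then the full subcategory on `P` is equivalent to the localization
at `W`. -/
theorem isEquivalence_ι_comp_Q (P : ObjectProperty C) (W : MorphismProperty C)
    (hW : W ≤ P.isColocal) (hP : ∀ X : C, ∃ (Y : C) (p : Y ⟶ X), P Y ∧ W p) :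
    (P.ι ⋙ W.Q).IsEquivalence := by
  choose Y p hY hp using hP
  let e (A : P.FullSubcategory) (X : C) :
      (P.ι.obj A ⟶ X) ≃ (A ⟶ (⟨Y X, hY X⟩ : P.FullSubcategory)) :=
    ((P.fullyFaithfulι.homEquiv).trans
      (Equiv.ofBijective _ (hW _ (hp X) A.obj A.property))).symm
  have he : ∀ (A B : P.FullSubcategory) (X : C) (f : A ⟶ B) (g : P.ι.obj B ⟶ X),
      e A X (P.ι.map f ≫ g) = f ≫ e B X g := by
    intro A B X f g
    obtain ⟨g, rfl⟩ := (e B X).symm.surjective g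
    rw [Equiv.apply_symm_apply, ← Equiv.eq_symm_apply]
    simp [e, Functor.FullyFaithful.homEquiv]
  let R : C ⥤ P.FullSubcategory :=
    Adjunction.rightAdjointOfEquiv (F := P.ι) (G_obj := fun X => ⟨Y X, hY X⟩) e he
  let adj : P.ι ⊣ R := Adjunction.adjunctionOfEquivRight e he
  have hc : ∀ X : C, adj.counit.app X = p X := by
    intro X
    simp [adj, Adjunction.adjunctionOfEquivRight, e, Functor.FullyFaithful.homEquiv]
  have hR : W.IsInvertedBy R := by
    intro X Z f hf
    have h0 : P.ι.map (R.map f) ≫ p Z = p X ≫ f := by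
      rw [← hc, ← hc]
      exact adj.counit_naturality f
    -- Colocal morphisms satisfy two-out-of-three, and between objects of `P` they are isomorphisms
    -- by Yoneda; hence `R` inverts `W`.
    have h1 : P.isColocal (P.ι.map (R.map f) ≫ p Z) := by
      rw [h0]
      exact MorphismProperty.comp_mem _ _ _ (hW _ (hp X)) (hW _ hf)
    have h2 := MorphismProperty.of_postcomp _ _ _ (hW _ (hp Z)) h1
    have := (P.isColocal_iff_isIso _ (R.obj X).property (R.obj Z).property).1 h2
    exact isIso_of_fully_faithful P.ι (R.map f)
  have : IsIso (Functor.whiskerRight adj.counit W.Q) := by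
    refine @NatIso.isIso_of_isIso_app _ _ _ _ _ _ _ fun X => ?_
    exact Localization.inverts W.Q W _ (by rw [hc]; exact hp X)
  exact (CategoryTheory.Equivalence.mk (P.ι ⋙ W.Q) (Localization.lift R hR W.Q)
    (asIso adj.unit ≪≫ Functor.isoWhiskerLeft P.ι (Localization.fac R hR W.Q).symm ≪≫
      (Functor.associator _ _ _).symm)
    (Localization.liftNatIso W.Q W (R ⋙ P.ι ⋙ W.Q) W.Q _ _
      (asIso (Functor.whiskerRight adj.counit W.Q)))).isEquivalence_functor

end Coreflection

/-! ### Acyclicity in terms of elements -/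

section Elements

variable {R : Type u} [Ring R]

/-- The iterated differential of a sequence of modules, as a linear map. -/
def seqMap (X : ℤ ⥤ ModuleCat.{u} R) {i j : ℤ} (h : i ≤ j) : X.obj i →ₗ[R] X.obj j :=
  (X.map (homOfLE h)).hom

lemma seqMap_refl (X : ℤ ⥤ ModuleCat.{u} R) {i : ℤ} (h : i ≤ i) (x : X.obj i) :
    seqMap X h x = x := by
  exact ConcreteCategory.congr_hom (X.map_id i) x

lemma seqMap_trans (X : ℤ ⥤ ModuleCat.{u} R) {i j k : ℤ} (h : i ≤ j) (h' : j ≤ k) (x : X.obj i) :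
    seqMap X h' (seqMap X h x) = seqMap X (h.trans h') x := by
  exact (ConcreteCategory.congr_hom (X.map_comp (homOfLE h) (homOfLE h')) x).symm

lemma seqMap_app {X Y : ℤ ⥤ ModuleCat.{u} R} (f : X ⟶ Y) {i j : ℤ} (h : i ≤ j) (x : X.obj i) :
    f.app j (seqMap X h x) = seqMap Y h (f.app i x) :=
  NatTrans.naturality_apply f (homOfLE h) x

variable {N : ℕ}

lemma isNComplex_iff (X : ℤ ⥤ ModuleCat.{u} R) :
    IsNComplex (ModuleCat.{u} R) N X ↔
      ∀ (i j : ℤ) (h : i ≤ j), i + N ≤ j → ∀ x : X.obj i, seqMap X h x = 0 := by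
  constructor
  · intro hX i j h h' x
    rw [← seqMap_trans X (by lia : i ≤ i + N) h']
    have : seqMap X (by lia : i ≤ i + N) x = 0 := by
      have := hX i
      simp [seqMap, this]
    rw [this, map_zero]
  · intro hX i
    ext x
    exact hX i _ _ le_rfl x

lemma seqMap_eq_zero (X : CN (ModuleCat.{u} R) N) {i j : ℤ} (h : i ≤ j) (h' : i + N ≤ j)
    (x : X.obj.obj i) : seqMap X.obj h x = 0 :=
  (isNComplex_iff X.obj).1 X.property i j h h' x

/-- Acyclicity of a sequence of modules in terms of elements. -/
def ElemAcyclic (N : ℕ) (X : ℤ ⥤ ModuleCat.{u} R) : Prop :=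
  ∀ (i j k : ℤ) (hij : i < j) (hjk : j < k), k = i + N →
    ∀ x : X.obj j, seqMap X hjk.le x = 0 → ∃ y : X.obj i, seqMap X hij.le y = x

lemma acyclic_iff (X : KN (ModuleCat.{u} R) N) :
    acyclic (ModuleCat.{u} R) N X ↔ ElemAcyclic N X.as.obj := by
  have key (r : ℕ) (hr : r ≤ N) (i : ℤ) : IsZero (cohomology X.as r hr i) ↔
      ∀ x : X.as.obj.obj i, seqMap X.as.obj (by lia : i ≤ i + r) x = 0 →
        ∃ y, seqMap X.as.obj (by lia : i - (N - r) ≤ i) y = x := by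
    rw [cohomology, ← ShortComplex.exact_iff_isZero_homology, ShortComplex.moduleCat_exact_iff]
    rfl
  constructor
  · intro h i j k hij hjk hk x hx
    obtain ⟨r, rfl⟩ : ∃ r : ℕ, k = j + r := ⟨(k - j).toNat, by lia⟩
    obtain rfl : i = j - (N - r) := by lia
    exact (key r (by lia) j).1 (h r (by lia) (by lia) j) x hx
  · intro h r h1 h2 i
    exact (key r h2.le i).2 fun x hx => h _ _ _ (by lia) (by lia) (by lia) x hx

/-- The kernel of a levelwise surjective morphism of acyclic sequences is acyclic. -/
lemma ElemAcyclic.of_kernel {K X Y : ℤ ⥤ ModuleCat.{u} R} (hX : ElemAcyclic N X)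
    (hY : ElemAcyclic N Y) (hXN : IsNComplex (ModuleCat.{u} R) N X)
    (f : K ⟶ X) (g : X ⟶ Y) (hf : ∀ n, Function.Injective (f.app n))
    (hg : ∀ n, Function.Surjective (g.app n)) (hfg : ∀ n, Function.Exact (f.app n) (g.app n)) :
    ElemAcyclic N K := by
  intro i j k hij hjk hk x hx
  obtain ⟨y, hy⟩ := hX i j k hij hjk hk (f.app j x) (by rw [← seqMap_app, hx, map_zero])
  -- A primitive `y` of `f x` need not lie in `K`. Its image in `Y` is a cycle, so it can be
  -- corrected by some `z` from degree `j - N`; this leaves the differential into degree `j`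
  -- unchanged because `d^N = 0`.
  obtain ⟨z, hz⟩ := hY (j - N) i j (by lia) hij (by lia) (g.app i y) (by
    rw [← seqMap_app, hy]; exact (hfg j).apply_apply_eq_zero x)
  obtain ⟨z, rfl⟩ := hg _ z
  rw [← seqMap_app, ← sub_eq_zero, ← map_sub] at hz
  obtain ⟨x', hx'⟩ := (hfg i _).1 hz
  refine ⟨-x', hf j ?_⟩
  rw [map_neg, map_neg, seqMap_app, hx', map_sub, seqMap_trans, hy,
    (isNComplex_iff X).1 hXN (j - N) j (by lia) (by lia)]
  simp

end Elements

/-! ### Disks and their universal properties -/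

section Disk

variable {R : Type u} [Ring R] {N : ℕ}

/-- The families `(s_a)` supported on the indices `a` with `a ≤ j < a + N`. -/
def diskLevel (M : ℤ → ModuleCat.{u} R) (N : ℕ) (j : ℤ) : Submodule R (∀ a, M a) where
  carrier := {s | ∀ a, ¬(a ≤ j ∧ j < a + N) → s a = 0}
  add_mem' hs ht a ha := by simp [hs a ha, ht a ha]
  zero_mem' _ _ := rfl
  smul_mem' c s hs a ha := by simp [hs a ha]

/-- The differential of `disk M N`: restriction of the support. -/
def diskMap (M : ℤ → ModuleCat.{u} R) (N : ℕ) {i j : ℤ} (h : i ≤ j) :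
    diskLevel M N i →ₗ[R] diskLevel M N j where
  toFun s := ⟨fun a => if j < a + N then s.1 a else 0, fun a ha => by
    by_cases h1 : j < a + N
    · exact (if_pos h1).trans (s.2 a (by lia))
    · exact if_neg h1⟩
  map_add' s t := by ext a; by_cases h1 : j < a + N <;> simp [h1]
  map_smul' c s := by ext a; by_cases h1 : j < a + N <;> simp [h1]

/-- The contractible complex which is the sum over `a` of `M a` placed in degrees `a`, …,
`a + N - 1`. -/
def disk (M : ℤ → ModuleCat.{u} R) (N : ℕ) : CN (ModuleCat.{u} R) N where
  obj :=
    { obj j := ModuleCat.of R (diskLevel M N j)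
      map f := ModuleCat.ofHom (diskMap M N (leOfHom f))
      map_id j := by
        ext s a
        by_cases h1 : j < a + N
        · simp [diskMap, h1]
        · simpa [diskMap, h1] using (s.2 a (by lia)).symm
      map_comp {i j k} f g := by
        ext s a
        have := leOfHom g
        by_cases h1 : k < a + N
        · simp [diskMap, h1, this.trans_lt h1]
        · simp [diskMap, h1] }
  property i := by
    ext s a
    by_cases h1 : i + N < a + N
    · exact (if_pos h1).trans (s.2 a (by lia))
    · exact if_neg h1

lemma seqMap_disk (M : ℤ → ModuleCat.{u} R) {i j : ℤ} (h : i ≤ j) (s : diskLevel M N i) :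
    seqMap (disk M N).obj h s = diskMap M N h s := rfl

/-- A component `s a ≠ 0` of degree `j` that dies in degree `k = i + N` must have `a ≤ i`, so the
same family already lives in degree `i`. -/
lemma elemAcyclic_disk (M : ℤ → ModuleCat.{u} R) : ElemAcyclic N (disk M N).obj := by
  intro i j k hij hjk hk (s : diskLevel M N j) hs
  refine ⟨(⟨s.1, fun a ha => ?_⟩ : diskLevel M N i), ?_⟩
  · by_cases h1 : a ≤ j ∧ j < a + N
    · have : (diskMap M N hjk.le s).1 a = 0 := by
        rw [← seqMap_disk, hs]; rfl
      simpa [diskMap, show k < a + N by lia] using this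
    · exact s.2 a h1
  · refine Subtype.ext (funext fun a => ?_)
    by_cases h1 : j < a + N
    · simp [seqMap_disk, diskMap, h1]
    · simpa [seqMap_disk, diskMap, h1] using (s.2 a (by lia)).symm

/-- Evaluation at the index `a`. -/
def diskEval (M : ℤ → ModuleCat.{u} R) (N : ℕ) (j a : ℤ) : (disk M N).obj.obj j →ₗ[R] M a :=
  show diskLevel M N j →ₗ[R] M a from (LinearMap.proj a).comp (diskLevel M N j).subtype

/-- The element of `disk M N` supported at a single index. -/
def diskSingle (M : ℤ → ModuleCat.{u} R) {N : ℕ} (j a : ℤ) (h : a ≤ j ∧ j < a + N) :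
    M a →ₗ[R] (disk M N).obj.obj j :=
  show M a →ₗ[R] diskLevel M N j from LinearMap.codRestrict _ (LinearMap.single R (fun a => M a) a) fun x b hb => by
    have : b ≠ a := by rintro rfl; exact hb h
    simp [this]

lemma diskEval_diskSingle (M : ℤ → ModuleCat.{u} R) (j a : ℤ) (h : a ≤ j ∧ j < a + N) (x : M a) :
    diskEval M N j a (diskSingle M j a h x) = x :=
  Pi.single_eq_same (M := fun a => M a) a x

lemma diskEval_diskSingle_of_ne (M : ℤ → ModuleCat.{u} R) (j a : ℤ) (h : a ≤ j ∧ j < a + N)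
    (x : M a) {b : ℤ} (hb : b ≠ a) : diskEval M N j b (diskSingle M j a h x) = 0 :=
  Pi.single_eq_of_ne (M := fun a => M a) hb x

/-- The morphism of complexes to `disk M N` given by a family of linear maps. -/
def toDisk (X : CN (ModuleCat.{u} R) N) (M : ℤ → ModuleCat.{u} R)
    (ψ : ∀ a b : ℤ, b = a + N - 1 → (X.obj.obj b →ₗ[R] M a)) : X ⟶ disk M N :=
  ObjectProperty.homMk
    { app j := ModuleCat.ofHom
        { toFun x := (⟨fun a => if h : a ≤ j ∧ j < a + N then
              ψ a (a + N - 1) rfl (seqMap X.obj (by lia : j ≤ a + N - 1) x) else 0,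
              fun a ha => dif_neg ha⟩ : diskLevel M N j)
          map_add' x y := by
            refine Subtype.ext (funext fun a => ?_)
            by_cases h : a ≤ j ∧ j < a + N <;> simp [h]
          map_smul' c x := by
            refine Subtype.ext (funext fun a => ?_)
            by_cases h : a ≤ j ∧ j < a + N <;> simp [h] }
      naturality i j f := by
        ext x
        refine Subtype.ext (funext fun a => ?_)
        have hf := leOfHom f
        change (if h : a ≤ j ∧ j < a + N then ψ a (a + N - 1) rfl
            (seqMap X.obj (by lia : j ≤ a + N - 1) (seqMap X.obj hf x)) else 0) =
          if j < a + N then (if h : a ≤ i ∧ i < a + N then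
            ψ a (a + N - 1) rfl (seqMap X.obj (by lia : i ≤ a + N - 1) x) else 0) else 0
        by_cases h : j < a + N
        · rw [if_pos h]
          by_cases h2 : a ≤ i
          · rw [dif_pos (by lia), dif_pos (by lia), seqMap_trans]
          -- Summand `a` starts after degree `i`, so the path from `i` to `a + N - 1` has at least
          -- `N` steps and vanishes.
          · rw [dif_neg (by lia : ¬(a ≤ i ∧ i < a + N))]
            split_ifs with h3
            · rw [seqMap_trans, seqMap_eq_zero X _ (by lia), map_zero]
            · rfl
        · rw [if_neg h, dif_neg (by lia)] }

lemma toDisk_app (X : CN (ModuleCat.{u} R) N) (M : ℤ → ModuleCat.{u} R)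
    (ψ : ∀ a b : ℤ, b = a + N - 1 → (X.obj.obj b →ₗ[R] M a)) (j : ℤ) (x : X.obj.obj j)
    (a : ℤ) (h : a ≤ j ∧ j < a + N) :
    diskEval M N j a ((toDisk X M ψ).hom.app j x) =
      ψ a (a + N - 1) rfl (seqMap X.obj (by lia : j ≤ a + N - 1) x) :=
  dif_pos h

lemma disk_ext {M : ℤ → ModuleCat.{u} R} {j : ℤ} {s t : (disk M N).obj.obj j}
    (h : ∀ a, a ≤ j ∧ j < a + N → diskEval M N j a s = diskEval M N j a t) : s = t := by
  refine Subtype.ext (funext fun a => ?_)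
  by_cases h1 : a ≤ j ∧ j < a + N
  · exact h a h1
  · exact (Subtype.property s a h1).trans (Subtype.property t a h1).symm

lemma diskEval_eq_zero {M : ℤ → ModuleCat.{u} R} {j a : ℤ} (h : ¬(a ≤ j ∧ j < a + N))
    (s : (disk M N).obj.obj j) : diskEval M N j a s = 0 :=
  Subtype.property s a h

lemma diskEval_seqMap (M : ℤ → ModuleCat.{u} R) {i j : ℤ} (h : i ≤ j) (s : (disk M N).obj.obj i)
    (a : ℤ) (ha : j < a + N) :
    diskEval M N j a (seqMap (disk M N).obj h s) = diskEval M N i a s :=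
  if_pos ha

/-- Component `a` is carried unchanged up to its last degree `a + N - 1`, so a map into a disk is
determined there. -/
lemma hom_disk_ext {X : CN (ModuleCat.{u} R) N} {M : ℤ → ModuleCat.{u} R} {f g : X ⟶ disk M N}
    (h : ∀ (a b : ℤ), b = a + N - 1 → ∀ x : X.obj.obj b,
      diskEval M N b a (f.hom.app b x) = diskEval M N b a (g.hom.app b x)) : f = g := by
  apply ObjectProperty.hom_ext
  ext j x
  refine disk_ext fun a ha => ?_
  have hj : j ≤ a + N - 1 := by lia
  have := h a _ rfl (seqMap X.obj hj x)
  rw [seqMap_app, seqMap_app] at this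
  rw [diskEval_seqMap _ _ _ _ (by lia), diskEval_seqMap _ _ _ _ (by lia)] at this
  exact this

/-- The iterated differential, extended by zero. -/
def seqMapOrZero (X : ℤ ⥤ ModuleCat.{u} R) (i j : ℤ) : X.obj i →ₗ[R] X.obj j :=
  if h : i ≤ j then seqMap X h else 0

lemma seqMap_seqMapOrZero (X : ℤ ⥤ ModuleCat.{u} R) {i j k : ℤ} (h : i ≤ j) (h' : j ≤ k)
    (x : X.obj i) : seqMap X h' (seqMapOrZero X i j x) = seqMapOrZero X i k x := by
  rw [seqMapOrZero, seqMapOrZero, dif_pos h, dif_pos (h.trans h'), seqMap_trans]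

lemma seqMapOrZero_eq_zero (X : CN (ModuleCat.{u} R) N) {i j : ℤ} (h' : i + N ≤ j)
    (x : X.obj.obj i) : seqMapOrZero X.obj i j x = 0 := by
  rw [seqMapOrZero, dif_pos (by lia), seqMap_eq_zero X _ h']

/-- The morphism of complexes from `disk M N` given by a family of linear maps. -/
def fromDisk (X : CN (ModuleCat.{u} R) N) (M : ℤ → ModuleCat.{u} R)
    (φ : ∀ a : ℤ, M a →ₗ[R] X.obj.obj a) : disk M N ⟶ X :=
  ObjectProperty.homMk
    { app j := ModuleCat.ofHom (∑ a ∈ Finset.Ioc (j - N) j,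
        (seqMapOrZero X.obj a j).comp ((φ a).comp (diskEval M N j a)))
      naturality i j f := by
        ext s
        have hf := leOfHom f
        change (∑ a ∈ Finset.Ioc (j - N) j, (seqMapOrZero X.obj a j).comp
            ((φ a).comp (diskEval M N j a))) (seqMap (disk M N).obj hf s) =
          seqMap X.obj hf ((∑ a ∈ Finset.Ioc (i - N) i, (seqMapOrZero X.obj a i).comp
            ((φ a).comp (diskEval M N i a))) s)
        simp only [LinearMap.sum_apply, map_sum, LinearMap.comp_apply]
        -- Both sums reduce to the common range: indices in `(i, j]` contribute nothing because `s`
        -- has no such component in degree `i`, and those in `(i - N, j - N]` die by `d^N = 0`.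
        trans ∑ a ∈ Finset.Ioc (j - N) i, seqMapOrZero X.obj a j (φ a (diskEval M N i a s))
        · symm
          refine Finset.sum_subset_zero_on_sdiff (Finset.Ioc_subset_Ioc_right hf) ?_ ?_
          · intro a ha
            have : diskEval M N j a (seqMap (disk M N).obj hf s) = 0 := by
              simp only [Finset.mem_sdiff, Finset.mem_Ioc] at ha
              exact (if_pos (by lia)).trans (diskEval_eq_zero (by lia) s)
            rw [this, map_zero, map_zero]
          · intro a ha
            simp only [Finset.mem_Ioc] at ha
            have : diskEval M N j a (seqMap (disk M N).obj hf s) = diskEval M N i a s := if_pos (by lia)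
            rw [this]
        · refine Finset.sum_subset_zero_on_sdiff (Finset.Ioc_subset_Ioc_left (by lia)) ?_ ?_
          · intro a ha
            simp only [Finset.mem_sdiff, Finset.mem_Ioc] at ha
            rw [seqMap_seqMapOrZero _ (by lia), seqMapOrZero_eq_zero _ (by lia)]
          · intro a ha
            simp only [Finset.mem_Ioc] at ha
            rw [seqMap_seqMapOrZero _ (by lia)] }

lemma fromDisk_single (X : CN (ModuleCat.{u} R) N) (M : ℤ → ModuleCat.{u} R)
    (φ : ∀ a : ℤ, M a →ₗ[R] X.obj.obj a) (a : ℤ) (h : a ≤ a ∧ a < a + N) (x : M a) :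
    (fromDisk X M φ).hom.app a (diskSingle M a a h x) = φ a x := by
  change (∑ b ∈ Finset.Ioc (a - N) a, (seqMapOrZero X.obj b a).comp
            ((φ b).comp (diskEval M N a b))) (diskSingle M a a h x) = _
  rw [LinearMap.sum_apply, Finset.sum_eq_single_of_mem a (by simp; lia)]
  · simp [seqMapOrZero, diskEval_diskSingle, seqMap_refl]
  · intro b _ hb
    simp [diskEval_diskSingle_of_ne _ _ _ _ _ hb]

lemma seqMap_diskSingle (M : ℤ → ModuleCat.{u} R) {a j : ℤ} (h : a ≤ a ∧ a < a + N)
    (h' : a ≤ j ∧ j < a + N) (x : M a) :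
    seqMap (disk M N).obj h'.1 (diskSingle M a a h x) = diskSingle M j a h' x := by
  refine disk_ext fun b hb => ?_
  rw [diskEval_seqMap _ _ _ _ hb.2]
  rfl

/-- Each element of a disk is a finite sum of iterated differentials of elements in the bottom
degrees of the summands. -/
lemma hom_ext_of_diskSingle {X : CN (ModuleCat.{u} R) N} {M : ℤ → ModuleCat.{u} R}
    {f g : disk M N ⟶ X}
    (h : ∀ (a : ℤ) (ha : a ≤ a ∧ a < a + N) (x : M a),
      f.hom.app a (diskSingle M a a ha x) = g.hom.app a (diskSingle M a a ha x)) : f = g := by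
  apply ObjectProperty.hom_ext
  ext j s
  have hs : s = ∑ a ∈ (Finset.Ioc (j - N) j).attach,
      diskSingle M j a.1 (by have := Finset.mem_Ioc.1 a.2; lia) (diskEval M N j a.1 s) := by
    refine disk_ext fun b hb => ?_
    rw [map_sum, Finset.sum_eq_single_of_mem ⟨b, by simp; lia⟩ (Finset.mem_attach _ _)]
    · rw [diskEval_diskSingle]
    · intro c _ hc
      have : b ≠ c.1 := by rintro rfl; exact hc rfl
      rw [diskEval_diskSingle_of_ne _ _ _ _ _ this]
  rw [hs, map_sum, map_sum]
  refine Finset.sum_congr rfl fun a _ => ?_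
  have ha := Finset.mem_Ioc.1 a.2
  rw [← seqMap_diskSingle M (by lia) (by lia), seqMap_app, seqMap_app, h]

end Disk

/-! ### Levelwise split sequences and enough projective-injectives -/

section ExactStructure

variable {R : Type u} [Ring R] {N : ℕ}

lemma comp_app_apply {X Y Z : CN (ModuleCat.{u} R) N} (f : X ⟶ Y) (g : Y ⟶ Z) (n : ℤ)
    (x : X.obj.obj n) : (f ≫ g).hom.app n x = g.hom.app n (f.hom.app n x) := rfl

lemma LevelwiseSplit.exists_section {S : ShortComplex (CN (ModuleCat.{u} R) N)}
    (hS : LevelwiseSplit S) (n : ℤ) : ∃ s : S.X₃.obj.obj n →ₗ[R] S.X₂.obj.obj n,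
      ∀ x, S.g.hom.app n (s x) = x := by
  obtain ⟨σ⟩ := hS n
  exact ⟨σ.s.hom, fun x => ConcreteCategory.congr_hom σ.s_g x⟩

lemma LevelwiseSplit.exists_retraction {S : ShortComplex (CN (ModuleCat.{u} R) N)}
    (hS : LevelwiseSplit S) (n : ℤ) : ∃ r : S.X₂.obj.obj n →ₗ[R] S.X₁.obj.obj n,
      ∀ x, r (S.f.hom.app n x) = x := by
  obtain ⟨σ⟩ := hS n
  exact ⟨σ.r.hom, fun x => ConcreteCategory.congr_hom σ.f_r x⟩

lemma LevelwiseSplit.injective {S : ShortComplex (CN (ModuleCat.{u} R) N)}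
    (hS : LevelwiseSplit S) (n : ℤ) : Function.Injective (S.f.hom.app n) := by
  obtain ⟨r, hr⟩ := hS.exists_retraction n
  exact Function.LeftInverse.injective hr

lemma LevelwiseSplit.surjective {S : ShortComplex (CN (ModuleCat.{u} R) N)}
    (hS : LevelwiseSplit S) (n : ℤ) : Function.Surjective (S.g.hom.app n) := by
  obtain ⟨r, hr⟩ := hS.exists_section n
  exact Function.RightInverse.surjective hr

lemma LevelwiseSplit.exact {S : ShortComplex (CN (ModuleCat.{u} R) N)}
    (hS : LevelwiseSplit S) (n : ℤ) : Function.Exact (S.f.hom.app n) (S.g.hom.app n) := by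
  obtain ⟨σ⟩ := hS n
  exact (ShortComplex.ShortExact.moduleCat_exact_iff_function_exact _).1 σ.exact

/-- A morphism killed by a levelwise surjective morphism factors through its kernel. -/
lemma exists_lift {K X Y T : CN (ModuleCat.{u} R) N} {f : K ⟶ X} {g : X ⟶ Y}
    (hf : ∀ n, Function.Injective (f.hom.app n))
    (hfg : ∀ n, Function.Exact (f.hom.app n) (g.hom.app n)) (t : T ⟶ X) (ht : t ≫ g = 0) :
    ∃ s : T ⟶ K, s ≫ f = t := by
  have h (n : ℤ) (x : T.obj.obj n) : ∃ y, f.hom.app n y = t.hom.app n x :=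
    (hfg n _).1 (by rw [← comp_app_apply, ht]; rfl)
  choose s hs using h
  refine ⟨ObjectProperty.homMk
    { app n := ModuleCat.ofHom
        { toFun := s n
          map_add' x y := hf n (by simp [hs])
          map_smul' c x := hf n (by simp [hs]) }
      naturality i j φ := ?_ }, ?_⟩
  · ext x
    apply hf j
    change f.hom.app j (s j (seqMap T.obj (leOfHom φ) x)) =
      f.hom.app j (seqMap K.obj (leOfHom φ) (s i x))
    rw [hs, seqMap_app, seqMap_app, hs]
  · apply ObjectProperty.hom_ext
    ext n x
    exact hs n x

/-- Maps out of a disk are free on the bottom degrees, where a levelwise section supplies the lift.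
-/
lemma isSplitProjective_disk (M : ℤ → ModuleCat.{u} R) : IsSplitProjective (disk M N) := by
  intro S hS a
  choose s hs using hS.exists_section
  refine ⟨fromDisk S.X₂ M fun n => if hn : n ≤ n ∧ n < n + N then
    (s n).comp ((a.hom.app n).hom.comp (diskSingle M n n hn)) else 0, ?_⟩
  refine hom_ext_of_diskSingle fun n hn x => ?_
  rw [comp_app_apply, fromDisk_single _ _ _ _ hn, dif_pos hn]
  exact hs n _

/-- Dually, maps into a disk are cofree on the top degrees, where a levelwise retraction supplies
the extension. -/
lemma isSplitInjective_disk (M : ℤ → ModuleCat.{u} R) : IsSplitInjective (disk M N) := by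
  intro S hS a
  choose r hr using hS.exists_retraction
  refine ⟨toDisk S.X₂ M fun n b _ =>
    (diskEval M N b n).comp ((a.hom.app b).hom.comp (r b)), ?_⟩
  refine hom_disk_ext fun n b hb x => ?_
  subst hb
  by_cases hn : n ≤ n + N - 1 ∧ n + N - 1 < n + N
  · rw [comp_app_apply, toDisk_app _ _ _ _ _ _ hn, seqMap_refl]
    simp [hr]
  · rw [diskEval_eq_zero hn, diskEval_eq_zero hn]

lemma levelwiseSplit_of_section {K X Y : CN (ModuleCat.{u} R) N} {f : K ⟶ X} {g : X ⟶ Y}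
    (w : f ≫ g = 0) (hf : ∀ n, Function.Injective (f.hom.app n))
    (hfg : ∀ n, Function.Exact (f.hom.app n) (g.hom.app n))
    (h : ∀ n, ∃ s : Y.obj.obj n →ₗ[R] X.obj.obj n, ∀ x, g.hom.app n (s x) = x) :
    LevelwiseSplit (ShortComplex.mk f g w) := by
  intro n
  obtain ⟨s, hs⟩ := h n
  refine ⟨ShortComplex.Splitting.ofExactOfSection _
    ((ShortComplex.ShortExact.moduleCat_exact_iff_function_exact _).2 (hfg n))
    (ModuleCat.ofHom s) ?_ ((ModuleCat.mono_iff_injective _).2 (hf n))⟩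
  ext x
  exact hs x

lemma levelwiseSplit_of_retraction {K X Y : CN (ModuleCat.{u} R) N} {f : K ⟶ X} {g : X ⟶ Y}
    (w : f ≫ g = 0) (hg : ∀ n, Function.Surjective (g.hom.app n))
    (hfg : ∀ n, Function.Exact (f.hom.app n) (g.hom.app n))
    (h : ∀ n, ∃ r : X.obj.obj n →ₗ[R] K.obj.obj n, ∀ x, r (f.hom.app n x) = x) :
    LevelwiseSplit (ShortComplex.mk f g w) := by
  intro n
  obtain ⟨r, hr⟩ := h n
  refine ⟨ShortComplex.Splitting.ofExactOfRetraction _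
    ((ShortComplex.ShortExact.moduleCat_exact_iff_function_exact _).2 (hfg n))
    (ModuleCat.ofHom r) ?_ ((ModuleCat.epi_iff_surjective _).2 (hg n))⟩
  ext x
  exact hr x

/-- Subsequences of an `N`-complex are `N`-complexes. -/
lemma isNComplex_of_injective {K X : ℤ ⥤ ModuleCat.{u} R} (hX : IsNComplex (ModuleCat.{u} R) N X)
    (f : K ⟶ X) (hf : ∀ n, Function.Injective (f.app n)) :
    IsNComplex (ModuleCat.{u} R) N K := by
  rw [isNComplex_iff] at hX ⊢
  intro i j h h' x
  apply hf
  rw [seqMap_app, hX i j h h', map_zero]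

/-- Quotients of an `N`-complex are `N`-complexes. -/
lemma isNComplex_of_surjective {X Y : ℤ ⥤ ModuleCat.{u} R}
    (hX : IsNComplex (ModuleCat.{u} R) N X) (f : X ⟶ Y)
    (hf : ∀ n, Function.Surjective (f.app n)) : IsNComplex (ModuleCat.{u} R) N Y := by
  rw [isNComplex_iff] at hX ⊢
  intro i j h h' y
  obtain ⟨x, rfl⟩ := hf i y
  rw [← seqMap_app, hX i j h h', map_zero]

lemma exact_app {S : ShortComplex (ℤ ⥤ ModuleCat.{u} R)} (hS : S.Exact) (n : ℤ) :
    Function.Exact (S.f.app n) (S.g.app n) :=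
  (ShortComplex.ShortExact.moduleCat_exact_iff_function_exact _).1
    (hS.map ((evaluation ℤ (ModuleCat.{u} R)).obj n))

lemma exists_kernel {X Y : ℤ ⥤ ModuleCat.{u} R} (g : X ⟶ Y) :
    ∃ (K : ℤ ⥤ ModuleCat.{u} R) (f : K ⟶ X), f ≫ g = 0 ∧
      (∀ n, Function.Injective (f.app n)) ∧ ∀ n, Function.Exact (f.app n) (g.app n) :=
  ⟨kernel g, kernel.ι g, kernel.condition g,
    fun _ => (ModuleCat.mono_iff_injective _).1 inferInstance,
    exact_app (S := ShortComplex.mk _ _ (kernel.condition g)) (ShortComplex.exact_kernel g)⟩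

lemma exists_cokernel {X Y : ℤ ⥤ ModuleCat.{u} R} (f : X ⟶ Y) :
    ∃ (C : ℤ ⥤ ModuleCat.{u} R) (g : Y ⟶ C), f ≫ g = 0 ∧
      (∀ n, Function.Surjective (g.app n)) ∧ ∀ n, Function.Exact (f.app n) (g.app n) :=
  ⟨cokernel f, cokernel.π f, cokernel.condition f,
    fun _ => (ModuleCat.epi_iff_surjective _).1 inferInstance,
    exact_app (S := ShortComplex.mk _ _ (cokernel.condition f)) (ShortComplex.exact_cokernel f)⟩

/-- There are enough objects which are both `S_⊕`-projective and `S_⊕`-injective: every complex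
is a levelwise split quotient of a disk. -/
lemma exists_disk_cover (X : CN (ModuleCat.{u} R) N) :
    ∃ (K : CN (ModuleCat.{u} R) N) (M : ℤ → ModuleCat.{u} R) (f : K ⟶ disk M N)
      (g : disk M N ⟶ X) (w : f ≫ g = 0), LevelwiseSplit (ShortComplex.mk f g w) := by
  let M : ℤ → ModuleCat.{u} R := fun n => X.obj.obj n
  let g : disk M N ⟶ X := fromDisk X M fun _ => LinearMap.id
  obtain ⟨K, f, w, hf, hfg⟩ := exists_kernel g.hom
  refine ⟨⟨K, isNComplex_of_injective (disk M N).property f hf⟩, M, ObjectProperty.homMk f, g,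
    by ext1; exact w, levelwiseSplit_of_section _ hf hfg fun n => ?_⟩
  by_cases h : n ≤ n ∧ n < n + N
  · exact ⟨diskSingle M n n h, fun x => fromDisk_single X M _ n h x⟩
  -- This case is `N = 0`: every level of `X` is zero.
  · refine ⟨0, fun x => ?_⟩
    rw [← seqMap_refl X.obj le_rfl x, seqMap_eq_zero X _ (by lia)]
    simp

/-- Every complex embeds levelwise split into a disk. -/
lemma exists_disk_hull (X : CN (ModuleCat.{u} R) N) :
    ∃ (M : ℤ → ModuleCat.{u} R) (f : X ⟶ disk M N),
      ∀ n, ∃ r : (disk M N).obj.obj n →ₗ[R] X.obj.obj n, ∀ x, r (f.hom.app n x) = x := by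
  let M : ℤ → ModuleCat.{u} R := fun n => X.obj.obj (n + N - 1)
  -- The structure map is the identity of `X^(a+N-1)`, written as a differential of length zero to
  -- absorb the index equality. The retraction in degree `n` reads off the summand whose top degree
  -- is `n`.
  refine ⟨M, toDisk X M fun n b hb => seqMap X.obj hb.le, fun n => ?_⟩
  by_cases h : n - N + 1 ≤ n ∧ n < n - N + 1 + N
  · refine ⟨(seqMap X.obj (by lia : n - N + 1 + N - 1 ≤ n)).comp (diskEval M N n (n - N + 1)),
      fun x => ?_⟩
    change seqMap X.obj _ (diskEval M N n (n - N + 1) _) = x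
    rw [toDisk_app _ _ _ _ _ _ h, seqMap_trans, seqMap_trans, seqMap_refl]
  · refine ⟨0, fun x => ?_⟩
    rw [← seqMap_refl X.obj le_rfl x, seqMap_eq_zero X _ (by lia)]
    simp

/-- An `S_⊕`-projective object is acyclic. -/
lemma IsSplitProjective.elemAcyclic {P : CN (ModuleCat.{u} R) N} (hP : IsSplitProjective P) :
    ElemAcyclic N P.obj := by
  obtain ⟨K, M, f, g, w, hS⟩ := exists_disk_cover P
  -- `P` is a retract of an acyclic disk.
  obtain ⟨s, hs : s ≫ g = 𝟙 P⟩ := hP _ hS (𝟙 P)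
  intro i j k hij hjk hk x hx
  obtain ⟨y, hy⟩ := elemAcyclic_disk (N := N) M i j k hij hjk hk (s.hom.app j x)
    (by rw [← seqMap_app, hx, map_zero])
  refine ⟨g.hom.app i y, ?_⟩
  rw [← seqMap_app, hy, ← comp_app_apply, hs]
  rfl

end ExactStructure

/-! ### Morphisms in the stable category -/

section Homotopy

variable {A : Type u} [Category.{v} A] [Preadditive A] [HasFiniteBiproducts A] {N : ℕ}

lemma quotient_map_eq_iff {X Y : CN A N} (f g : X ⟶ Y) :
    (KN.quotient A N).map f = (KN.quotient A N).map g ↔ FactorsThroughInjProj (f - g) :=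
  Quotient.functor_map_eq_iff (stableRel A N) f g

lemma quotient_map_eq_zero_iff {X Y : CN A N} (f : X ⟶ Y) :
    (KN.quotient A N).map f = 0 ↔ FactorsThroughInjProj f := by
  have := quotient_map_eq_iff f 0
  rwa [sub_zero] at this

omit [HasFiniteBiproducts A] in
lemma exists_eq_quotient_obj (X : KN A N) : ∃ Y : CN A N, X = (KN.quotient A N).obj Y :=
  ⟨X.as, rfl⟩

omit [HasFiniteBiproducts A] in
lemma quotient_map_surjective {X Y : CN A N}
    (f : (KN.quotient A N).obj X ⟶ (KN.quotient A N).obj Y) :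
    ∃ g : X ⟶ Y, (KN.quotient A N).map g = f :=
  (Quotient.functor (stableRel A N)).map_surjective f

end Homotopy

/-! ### Colocality of morphisms with acyclic cone -/

section HProjective

variable {R : Type u} [Ring R] {N : ℕ}

lemma acyclic_quotient_iff (X : CN (ModuleCat.{u} R) N) :
    acyclic (ModuleCat.{u} R) N ((KN.quotient _ N).obj X) ↔ ElemAcyclic N X.obj :=
  acyclic_iff _

/-- Acyclicity is invariant under isomorphisms in the homotopy category. -/
lemma acyclic_of_iso {X Y : KN (ModuleCat.{u} R) N} (e : X ≅ Y)
    (hY : acyclic (ModuleCat.{u} R) N Y) : acyclic (ModuleCat.{u} R) N X := by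
  obtain ⟨X, rfl⟩ := exists_eq_quotient_obj X
  obtain ⟨Y, rfl⟩ := exists_eq_quotient_obj Y
  rw [acyclic_quotient_iff] at hY ⊢
  obtain ⟨f, hf⟩ := quotient_map_surjective e.hom
  obtain ⟨g, hg⟩ := quotient_map_surjective e.inv
  -- Modulo `f ≫ g` the identity factors through an acyclic object, so a cycle `x` is the sum of two
  -- boundaries.
  obtain ⟨P, a, b, -, hP, hab⟩ := (quotient_map_eq_iff (𝟙 X) (f ≫ g)).1 (by
    rw [Functor.map_comp, hf, hg, e.hom_inv_id, CategoryTheory.Functor.map_id])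
  intro i j k hij hjk hk x hx
  obtain ⟨y, hy⟩ := hY i j k hij hjk hk (f.hom.app j x) (by rw [← seqMap_app, hx, map_zero])
  obtain ⟨z, hz⟩ := hP.elemAcyclic i j k hij hjk hk (a.hom.app j x)
    (by rw [← seqMap_app, hx, map_zero])
  refine ⟨g.hom.app i y + b.hom.app i z, ?_⟩
  rw [map_add, ← seqMap_app, ← seqMap_app, hy, hz, ← comp_app_apply, ← comp_app_apply, hab]
  exact add_sub_cancel ((f ≫ g).hom.app j x) x

variable {P : CN (ModuleCat.{u} R) N}
  (hP : ∀ Y : CN (ModuleCat.{u} R) N, ElemAcyclic N Y.obj → ∀ f : P ⟶ Y, FactorsThroughInjProj f)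
  {S : ShortComplex (CN (ModuleCat.{u} R) N)} (hS : LevelwiseSplit S)
  (hS₃ : ElemAcyclic N S.X₃.obj)

include hP hS hS₃

/-- Surjectivity half of colocality: `g ≫ S.g` is null since `S.X₃` is acyclic, and lifting the
null-factorization through `S.g` corrects `g` to a map landing in `S.X₁`. -/
lemma exists_factorsThroughInjProj_sub (g : P ⟶ S.X₂) :
    ∃ h : P ⟶ S.X₁, FactorsThroughInjProj (h ≫ S.f - g) := by
  obtain ⟨I, a, b, hI, hI', hab⟩ := hP _ hS₃ (g ≫ S.g)
  obtain ⟨b', hb'⟩ := hI' S hS b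
  obtain ⟨h, hh⟩ := exists_lift hS.injective hS.exact (g - a ≫ b')
    (by rw [Preadditive.sub_comp, Category.assoc, hb', hab, sub_self])
  exact ⟨h, I, -a, b', hI, hI', by rw [hh, Preadditive.neg_comp, sub_sub_cancel_left]⟩

/-- Injectivity half. The kernel `K` of a disk cover of `S.X₃` serves as its desuspension and is
again acyclic. The map `g` is the sum of one map through `I` and one through the null map `k : P ⟶
K`, composed with the connecting map `τ : K ⟶ S.X₁`. -/
lemma factorsThroughInjProj_of_comp (g : P ⟶ S.X₁) (hg : FactorsThroughInjProj (g ≫ S.f)) :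
    FactorsThroughInjProj g := by
  obtain ⟨I, a, b, hI, hI', hab⟩ := hg
  obtain ⟨K, M, i, p, w, hT⟩ := exists_disk_cover S.X₃
  obtain ⟨σ, hσ⟩ := isSplitProjective_disk M S hS p
  obtain ⟨c, hc : c ≫ p = b ≫ S.g⟩ := hI' _ hT (b ≫ S.g)
  have hK : ElemAcyclic N K.obj := ElemAcyclic.of_kernel (elemAcyclic_disk M) hS₃
    (disk M N).property i.hom p.hom hT.injective hT.surjective hT.exact
  obtain ⟨k, hk : k ≫ i = a ≫ c⟩ := exists_lift hT.injective hT.exact (a ≫ c) (by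
    change (a ≫ c) ≫ p = 0
    rw [Category.assoc, hc, ← Category.assoc, hab, Category.assoc, S.zero, comp_zero])
  obtain ⟨τ, hτ⟩ := exists_lift hS.injective hS.exact (i ≫ σ)
    (by rw [Category.assoc, hσ, w])
  obtain ⟨e, he⟩ := exists_lift hS.injective hS.exact (b - c ≫ σ)
    (by rw [Preadditive.sub_comp, Category.assoc, hσ, hc, sub_self])
  have hcomp : g ≫ S.f = (a ≫ e + k ≫ τ) ≫ S.f := by
    rw [Preadditive.add_comp, Category.assoc, Category.assoc, he, hτ, ← Category.assoc k, hk,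
      Preadditive.comp_sub, hab, Category.assoc, sub_add_cancel]
  have hsum : g = a ≫ e + k ≫ τ := by
    apply ObjectProperty.hom_ext
    ext n x
    apply hS.injective n
    rw [← comp_app_apply, ← comp_app_apply, hcomp]
  rw [hsum]
  exact .add ⟨I, a, e, hI, hI', rfl⟩ ((hP K hK k).comp_right τ)

omit hP hS hS₃ in
/-- Morphisms with an acyclic cone are colocal for the h-projective objects. -/
lemma acyclicCone_le_isColocal :
    acyclicCone (ModuleCat.{u} R) N ≤ (hproj (ModuleCat.{u} R) N).isColocal := by
  rintro X Y f ⟨Z, ⟨S, hS, ⟨e⟩, ⟨e'⟩⟩, hZ⟩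
  rw [(hproj (ModuleCat.{u} R) N).isColocal.arrow_mk_iso_iff e]
  have hS₃ := (acyclic_quotient_iff _).1 (acyclic_of_iso e'.symm hZ)
  intro P hP
  obtain ⟨P, rfl⟩ := exists_eq_quotient_obj P
  have hP' : ∀ Y : CN (ModuleCat.{u} R) N, ElemAcyclic N Y.obj →
      ∀ f : P ⟶ Y, FactorsThroughInjProj f := fun Y hY f => by
    rw [← quotient_map_eq_zero_iff]
    exact hP _ ((acyclic_quotient_iff Y).2 hY) _
  constructor
  · intro g₁ g₂ h
    obtain ⟨g₁, rfl⟩ := quotient_map_surjective g₁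
    obtain ⟨g₂, rfl⟩ := quotient_map_surjective g₂
    refine (quotient_map_eq_iff _ _).2 (factorsThroughInjProj_of_comp hP' hS hS₃ _ ?_)
    rw [Preadditive.sub_comp, ← quotient_map_eq_iff, Functor.map_comp, Functor.map_comp]
    exact h
  · intro g
    obtain ⟨g, rfl⟩ := quotient_map_surjective g
    obtain ⟨h, hh⟩ := exists_factorsThroughInjProj_sub hP' hS hS₃ g
    refine ⟨(KN.quotient _ N).map h, ?_⟩
    exact ((KN.quotient _ N).map_comp _ _).symm.trans ((quotient_map_eq_iff _ _).2 hh)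

end HProjective

/-! ### Finitely presentable sequences representing elements and cycles -/

section Spheres

variable (R : Type u) [Ring R]

/-- The free sequence on a generator in degree `a`. -/
def freeSeq (a : ℤ) : ℤ ⥤ ModuleCat.{u} R :=
  (evaluationLeftAdjoint (ModuleCat.{u} R) a).obj ((ModuleCat.free R).obj PUnit.{u + 1})

/-- Morphisms from the free sequence on a generator in degree `a` are elements of degree `a`. -/
def freeSeqEquiv (a : ℤ) (X : ℤ ⥤ ModuleCat.{u} R) : (freeSeq R a ⟶ X) ≃ X.obj a :=
  (((ModuleCat.adj R).comp (evaluationAdjunctionRight (ModuleCat.{u} R) a)).homEquiv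
    PUnit.{u + 1} X).trans
      { toFun f := f PUnit.unit
        invFun x := TypeCat.ofHom fun _ => x
        left_inv _ := rfl
        right_inv _ := rfl }

/-- The generator of the free sequence. -/
def freeSeqGen (a : ℤ) : (freeSeq R a).obj a := freeSeqEquiv R a _ (𝟙 _)

variable {R}

lemma freeSeqEquiv_comp {a : ℤ} {X Y : ℤ ⥤ ModuleCat.{u} R} (φ : freeSeq R a ⟶ X) (f : X ⟶ Y) :
    freeSeqEquiv R a Y (φ ≫ f) = f.app a (freeSeqEquiv R a X φ) := by
  exact ConcreteCategory.congr_hom (((ModuleCat.adj R).comp (evaluationAdjunctionRight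
    (ModuleCat.{u} R) a)).homEquiv_naturality_right φ f) PUnit.unit

lemma freeSeqEquiv_apply {a : ℤ} {X : ℤ ⥤ ModuleCat.{u} R} (φ : freeSeq R a ⟶ X) :
    freeSeqEquiv R a X φ = φ.app a (freeSeqGen R a) := by
  rw [freeSeqGen, ← freeSeqEquiv_comp, Category.id_comp]

/-- The right adjoint `X ↦ X^a` to sets preserves filtered colimits, so the left adjoint sends a
point to a finitely presentable object; this feeds the small object argument. -/
instance (a : ℤ) : IsFinitelyPresentable.{u} (freeSeq R a) := by
  have : Fact Cardinal.aleph0.{u}.IsRegular := Cardinal.fact_isRegular_aleph0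
  have : IsCardinalPresentable PUnit.{u + 1} Cardinal.aleph0.{u} :=
    HasCardinalLT.isCardinalPresentable (hasCardinalLT_aleph0_iff _ |>.2 inferInstance)
  have : (((evaluation ℤ (ModuleCat.{u} R)).obj a) ⋙
      forget (ModuleCat.{u} R)).IsCardinalAccessible Cardinal.aleph0.{u} :=
    Functor.isFinitelyAccessible_iff_preservesFilteredColimits.2 inferInstance
  exact ((ModuleCat.adj R).comp (evaluationAdjunctionRight
    (ModuleCat.{u} R) a)).isCardinalPresentable_leftAdjoint_obj .aleph0 PUnit.{u + 1}

/-- The map of free sequences sending the generator of degree `b` to the differential of the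
generator of degree `a`. -/
def freeSeqMap {a b : ℤ} (h : a ≤ b) : freeSeq R b ⟶ freeSeq R a :=
  (freeSeqEquiv R b _).symm (seqMap _ h (freeSeqGen R a))

/-- The sequence with a generator in degree `a` which vanishes in degree `b`. -/
abbrev sphere (R : Type u) [Ring R] {a b : ℤ} (h : a ≤ b) : ℤ ⥤ ModuleCat.{u} R :=
  cokernel (freeSeqMap (R := R) h)

/-- The generator of `sphere R h`. -/
def sphereGen (R : Type u) [Ring R] {a b : ℤ} (h : a ≤ b) : (sphere R h).obj a :=
  freeSeqEquiv R a _ (cokernel.π (freeSeqMap (R := R) h))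

lemma freeSeqEquiv_freeSeqMap_comp {a b : ℤ} (h : a ≤ b) {X : ℤ ⥤ ModuleCat.{u} R}
    (φ : freeSeq R a ⟶ X) :
    freeSeqEquiv R b X (freeSeqMap h ≫ φ) = seqMap X h (freeSeqEquiv R a X φ) := by
  rw [freeSeqEquiv_comp, freeSeqMap, Equiv.apply_symm_apply, seqMap_app, freeSeqEquiv_apply]

lemma seqMap_sphereGen {a b : ℤ} (h : a ≤ b) : seqMap _ h (sphereGen R h) = 0 := by
  rw [sphereGen, ← freeSeqEquiv_freeSeqMap_comp, cokernel.condition, freeSeqEquiv_apply]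
  rfl

lemma sphere_hom_ext {a b : ℤ} {h : a ≤ b} {X : ℤ ⥤ ModuleCat.{u} R} {f g : sphere R h ⟶ X}
    (hfg : f.app a (sphereGen R h) = g.app a (sphereGen R h)) : f = g := by
  apply coequalizer.hom_ext
  apply (freeSeqEquiv R a X).injective
  exact (freeSeqEquiv_comp _ _).trans (hfg.trans (freeSeqEquiv_comp _ _).symm)

/-- With `sphere_hom_ext`, this says that `sphere R h` represents `X ↦ ker (X^a ⟶ X^b)`. -/
lemma exists_sphere_hom {a b : ℤ} (h : a ≤ b) (X : ℤ ⥤ ModuleCat.{u} R) (x : X.obj a)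
    (hx : seqMap X h x = 0) : ∃ f : sphere R h ⟶ X, f.app a (sphereGen R h) = x := by
  have h0 : freeSeqMap (R := R) h ≫ (freeSeqEquiv R a X).symm x = 0 := by
    apply (freeSeqEquiv R b X).injective
    rw [freeSeqEquiv_freeSeqMap_comp, Equiv.apply_symm_apply, hx, freeSeqEquiv_apply]
    rfl
  refine ⟨cokernel.desc _ _ h0, ?_⟩
  rw [sphereGen, ← freeSeqEquiv_comp, cokernel.π_desc, Equiv.apply_symm_apply]

instance {a b : ℤ} (h : a ≤ b) : IsFinitelyPresentable.{u} (sphere R h) := by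
  have : Fact Cardinal.aleph0.{u}.IsRegular := Cardinal.fact_isRegular_aleph0
  have : ∀ k, IsCardinalPresentable ((parallelPair (freeSeqMap (R := R) h) 0).obj k)
      Cardinal.aleph0.{u} := by
    rintro (_ | _)
    · exact inferInstanceAs (IsFinitelyPresentable.{u} (freeSeq R b))
    · exact inferInstanceAs (IsFinitelyPresentable.{u} (freeSeq R a))
  exact isCardinalPresentable_of_isColimit' _ (cokernelIsCokernel (freeSeqMap (R := R) h))
    Cardinal.aleph0.{u} (hasCardinalLT_aleph0_iff _ |>.2 inferInstance)

end Spheres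

/-! ### Cofibrant resolutions by the small object argument -/

section Resolution

open scoped ZeroObject

variable (R : Type u) [Ring R] (N : ℕ)

/-- The morphism of spheres sending the generator of degree `j` to the differential of the
generator of degree `c`. -/
def sphereMap {c j k : ℤ} (h : c ≤ j) (h' : j ≤ k) : sphere R h' ⟶ sphere R (h.trans h') :=
  (exists_sphere_hom h' (sphere R (h.trans h')) (seqMap _ h (sphereGen R (h.trans h')))
    (by rw [seqMap_trans, seqMap_sphereGen])).choose

lemma sphereMap_app_gen {c j k : ℤ} (h : c ≤ j) (h' : j ≤ k) :
    (sphereMap R h h').app j (sphereGen R h') = seqMap _ h (sphereGen R (h.trans h')) :=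
  (exists_sphere_hom h' (sphere R (h.trans h')) (seqMap _ h (sphereGen R (h.trans h')))
    (by rw [seqMap_trans, seqMap_sphereGen])).choose_spec

/-- The generating cofibrations: the inclusions of spheres into disks. -/
def generatingCofibrations : MorphismProperty (ℤ ⥤ ModuleCat.{u} R) :=
  -- The target is the free `N`-complex on a generator of degree `t.1`. For `t.2 = t.1 + N` the
  -- source is zero, and lifting expresses surjectivity on elements killed by `d^N`.
  MorphismProperty.ofHoms (fun t : {t : ℤ × ℤ // t.1 ≤ t.2 ∧ t.2 ≤ t.1 + N} =>
    sphereMap R t.2.1 t.2.2)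

instance : MorphismProperty.IsSmall.{u} (generatingCofibrations R N) :=
  by
  have : Small.{u} {t : ℤ × ℤ // t.1 ≤ t.2 ∧ t.2 ≤ t.1 + N} := Countable.toSmall _
  exact MorphismProperty.isSmall_ofHoms _

attribute [local instance] Cardinal.fact_isRegular_aleph0
  Cardinal.orderBotAleph0OrdToType

instance : MorphismProperty.IsCardinalForSmallObjectArgument
    (generatingCofibrations R N) Cardinal.aleph0.{u} where
  preservesColimit {A B X Y} i hi f hf := by
    have : IsFinitelyPresentable.{u} A := by
      obtain ⟨i⟩ := hi
      infer_instance
    infer_instance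

instance : MorphismProperty.HasSmallObjectArgument.{u} (generatingCofibrations R N) :=
  ⟨.aleph0, inferInstance, inferInstance, inferInstance⟩

variable {R N}

/-- Since spheres represent kernels of differentials, a square is a compatible pair `(p, x)` and a
lift is an element `q`. -/
lemma generatingCofibrations_rlp_iff {P X : ℤ ⥤ ModuleCat.{u} R} (f : P ⟶ X) :
    (generatingCofibrations R N).rlp f ↔
      ∀ (c j : ℤ) (h : c ≤ j) (h' : j ≤ c + N) (p : P.obj j) (x : X.obj c),
        seqMap P h' p = 0 → seqMap X (h.trans h') x = 0 → f.app j p = seqMap X h x →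
          ∃ q : P.obj c, seqMap P (h.trans h') q = 0 ∧ seqMap P h q = p ∧ f.app c q = x := by
  constructor
  · intro hf c j h h' p x hp hx hpx
    obtain ⟨φ, hφ⟩ := exists_sphere_hom h' P p hp
    obtain ⟨ψ, hψ⟩ := exists_sphere_hom (h.trans h') X x hx
    have sq : CommSq φ (sphereMap R h h') f ψ := ⟨sphere_hom_ext (by
      rw [NatTrans.comp_app, NatTrans.comp_app, ConcreteCategory.comp_apply,
        ConcreteCategory.comp_apply, hφ, hpx, sphereMap_app_gen, seqMap_app, hψ])⟩
    have := hf _ (MorphismProperty.ofHoms.mk (⟨(c, j), h, h'⟩ : {t : ℤ × ℤ // t.1 ≤ t.2 ∧ t.2 ≤ t.1 + N}))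
    refine ⟨sq.lift.app c (sphereGen R (h.trans h')), ?_, ?_, ?_⟩
    · rw [← seqMap_app, seqMap_sphereGen, map_zero]
    · rw [← seqMap_app, ← sphereMap_app_gen R h h', ← ConcreteCategory.comp_apply, ← NatTrans.comp_app,
        sq.fac_left, hφ]
    · rw [← ConcreteCategory.comp_apply, ← NatTrans.comp_app, sq.fac_right, hψ]
  · rintro hf _ _ _ ⟨⟨⟨c, j⟩, h, h'⟩⟩
    refine ⟨fun {φ ψ} sq => ?_⟩
    dsimp at h h' φ ψ sq
    obtain ⟨q, hq, hq₁, hq₂⟩ := hf c j h h' (φ.app j (sphereGen R h'))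
      (ψ.app c (sphereGen R (h.trans h'))) (by rw [← seqMap_app, seqMap_sphereGen, map_zero])
      (by rw [← seqMap_app, seqMap_sphereGen, map_zero])
      (by rw [← ConcreteCategory.comp_apply, ← NatTrans.comp_app, sq.w, NatTrans.comp_app,
        ConcreteCategory.comp_apply, sphereMap_app_gen, seqMap_app])
    obtain ⟨l, hl⟩ := exists_sphere_hom (h.trans h') P q hq
    refine ⟨⟨⟨l, sphere_hom_ext ?_, sphere_hom_ext ?_⟩⟩⟩
    · rw [NatTrans.comp_app, ConcreteCategory.comp_apply, sphereMap_app_gen, seqMap_app, hl, hq₁]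
    · rw [NatTrans.comp_app, ConcreteCategory.comp_apply, hl, hq₂]

/-- A levelwise surjective morphism of `N`-complexes with acyclic kernel lifts against the
generating cofibrations. -/
lemma generatingCofibrations_rlp_of_acyclic {K X Y : CN (ModuleCat.{u} R) N} (f : K ⟶ X)
    (g : X ⟶ Y) (hg : ∀ n, Function.Surjective (g.hom.app n))
    (hfg : ∀ n, Function.Exact (f.hom.app n) (g.hom.app n))
    (hf : ∀ n, Function.Injective (f.hom.app n)) (hK : ElemAcyclic N K.obj) :
    (generatingCofibrations R N).rlp g.hom := by
  rw [generatingCofibrations_rlp_iff]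
  intro c j h h' p x hp hx hpx
  obtain ⟨q, rfl⟩ := hg c x
  rw [← seqMap_app, ← sub_eq_zero, ← map_sub] at hpx
  rcases h.eq_or_lt with rfl | h
  · refine ⟨p, hp, seqMap_refl _ _ _, ?_⟩
    rwa [seqMap_refl, map_sub, sub_eq_zero] at hpx
  rcases h'.eq_or_lt with rfl | h'
  · refine ⟨q, seqMap_eq_zero X _ le_rfl q, ?_, rfl⟩
    rw [seqMap_refl] at hp
    rw [hp, seqMap_eq_zero X _ le_rfl q]
  · obtain ⟨k, hk⟩ := (hfg j _).1 hpx
    obtain ⟨l, hl⟩ := hK c j (c + N) h h' rfl k (hf _ (by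
      rw [seqMap_app, hk, map_sub, hp, seqMap_trans, seqMap_eq_zero X _ le_rfl]
      simp))
    -- The defect `p - d q` is a cycle of the acyclic kernel; a primitive `l` of it corrects `q`
    -- without changing its image.
    refine ⟨q + f.hom.app c l, seqMap_eq_zero X _ le_rfl _, ?_, ?_⟩
    · rw [map_add, ← seqMap_app, hl, hk, add_sub_cancel]
    · rw [map_add, (hfg c).apply_apply_eq_zero, add_zero]

/-- Every `N`-complex has a resolution by a cofibrant `N`-complex. -/
lemma exists_cofibrant_resolution (X : CN (ModuleCat.{u} R) N) :
    ∃ (P : CN (ModuleCat.{u} R) N) (f : P ⟶ X), (generatingCofibrations R N).rlp f.hom ∧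
      (generatingCofibrations R N).rlp.llp (0 : (0 : ℤ ⥤ ModuleCat.{u} R) ⟶ P.obj) := by
  let I := generatingCofibrations R N
  let d := MorphismProperty.factorizationData I.rlp.llp I.rlp
    (0 : (0 : ℤ ⥤ ModuleCat.{u} R) ⟶ X.obj)
  have hP : IsNComplex (ModuleCat.{u} R) N d.Z := by
    let F : ℤ ⥤ ℤ := Monotone.functor (f := fun i : ℤ => i + N) fun a b h => by lia
    let g : d.Z ⟶ F ⋙ d.Z :=
      { app i := d.Z.map (homOfLE (by lia : i ≤ i + N))
        naturality i j φ := by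
          rw [Functor.comp_map, ← d.Z.map_comp, ← d.Z.map_comp]
          rfl }
    obtain ⟨K, k, hk, hk₁, hk₂⟩ := exists_kernel g
    -- The inclusion of `ker d^N` lifts against every generator because the targets only see
    -- elements killed by `d^N`. The identity of the cofibrant `d.Z` then factors through this
    -- kernel, forcing `d^N = 0`.
    have hkI : I.rlp k := by
      rw [generatingCofibrations_rlp_iff]
      intro c j h h' p x hp hx hpx
      obtain ⟨q, rfl⟩ := (hk₂ c x).1 hx
      exact ⟨q, hk₁ _ (by rw [seqMap_app, hx, map_zero]),
        hk₁ _ (by rw [seqMap_app, hpx]), rfl⟩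
    have sq : CommSq (0 : (0 : ℤ ⥤ ModuleCat.{u} R) ⟶ K) d.i k (𝟙 d.Z) :=
      ⟨(isZero_zero _).eq_of_src _ _⟩
    have := d.hi _ hkI
    intro i
    ext x
    refine (hk₂ i x).2 ⟨sq.lift.app i x, ?_⟩
    rw [← ConcreteCategory.comp_apply, ← NatTrans.comp_app, sq.fac_right]
    rfl
  refine ⟨⟨d.Z, hP⟩, ObjectProperty.homMk d.p, d.hp, ?_⟩
  have := d.hi
  rwa [(isZero_zero _).eq_of_src d.i 0] at this

end Resolution

/-! ### Cofibrant objects are h-projective and trivial fibrations have acyclic cone -/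

section Main

open scoped ZeroObject

variable {R : Type u} [Ring R] {N : ℕ}

/-- Cofibrant complexes are h-projective. -/
lemma hproj_of_llp (P : CN (ModuleCat.{u} R) N)
    (hP : (generatingCofibrations R N).rlp.llp (0 : (0 : ℤ ⥤ ModuleCat.{u} R) ⟶ P.obj)) :
    hproj (ModuleCat.{u} R) N ((KN.quotient _ N).obj P) := by
  intro Y hY f
  obtain ⟨Y, rfl⟩ := exists_eq_quotient_obj Y
  obtain ⟨f, rfl⟩ := quotient_map_surjective f
  rw [acyclic_quotient_iff] at hY
  rw [quotient_map_eq_zero_iff]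
  obtain ⟨K, M, i, p, w, hS⟩ := exists_disk_cover Y
  have hK : ElemAcyclic N K.obj := ElemAcyclic.of_kernel (elemAcyclic_disk M) hY
    (disk M N).property i.hom p.hom hS.injective hS.surjective hS.exact
  have := hP _ (generatingCofibrations_rlp_of_acyclic i p hS.surjective hS.exact hS.injective hK)
  have sq : CommSq (0 : (0 : ℤ ⥤ ModuleCat.{u} R) ⟶ (disk M N).obj) 0 p.hom f.hom :=
    ⟨(isZero_zero _).eq_of_src _ _⟩
  exact ⟨disk M N, ObjectProperty.homMk sq.lift, p, isSplitInjective_disk M,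
    isSplitProjective_disk M, ObjectProperty.hom_ext _ sq.fac_right⟩

/-- Lifting against the generator with zero source, `j = n + N`. -/
lemma surjective_of_rlp {P X : CN (ModuleCat.{u} R) N} (f : P ⟶ X)
    (hf : (generatingCofibrations R N).rlp f.hom) (n : ℤ) :
    Function.Surjective (f.hom.app n) := by
  intro x
  rw [generatingCofibrations_rlp_iff] at hf
  obtain ⟨q, -, -, hq⟩ := hf n (n + N) (by lia) le_rfl 0 x (map_zero _)
    (seqMap_eq_zero X _ le_rfl x) (by rw [seqMap_eq_zero X _ le_rfl, map_zero])
  exact ⟨q, hq⟩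

/-- Lifting with `x = 0`: cycles in the kernel of `f` have primitives in that kernel. -/
lemma exists_seqMap_eq_of_rlp {P X : CN (ModuleCat.{u} R) N} (f : P ⟶ X)
    (hf : (generatingCofibrations R N).rlp f.hom) {i j k : ℤ} (hij : i ≤ j) (hjk : j ≤ k)
    (hk : k = i + N) (p : P.obj.obj j) (hp : seqMap P.obj hjk p = 0) (hfp : f.hom.app j p = 0) :
    ∃ q, seqMap P.obj hij q = p ∧ f.hom.app i q = 0 := by
  subst hk
  rw [generatingCofibrations_rlp_iff] at hf
  obtain ⟨q, -, hq, hq'⟩ := hf i j hij hjk p 0 hp (map_zero _) (by rw [hfp, map_zero])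
  exact ⟨q, hq, hq'⟩

/-- Trivial fibrations have an acyclic cone. -/
lemma acyclicCone_of_rlp {P X : CN (ModuleCat.{u} R) N} (f : P ⟶ X)
    (hf : (generatingCofibrations R N).rlp f.hom) :
    acyclicCone (ModuleCat.{u} R) N ((KN.quotient _ N).map f) := by
  obtain ⟨M, i, hi⟩ := exists_disk_hull P
  let D := disk M N
  -- Adding a disk hull makes `f` a levelwise split monomorphism without changing it in the stable
  -- category, where `D` vanishes.
  let l : P ⟶ X ⊞ D := biprod.lift f i
  have hl₁ (n : ℤ) (p : P.obj.obj n) :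
      (biprod.fst : X ⊞ D ⟶ X).hom.app n (l.hom.app n p) = f.hom.app n p := by
    rw [← comp_app_apply, biprod.lift_fst]
  have hl₂ (n : ℤ) (p : P.obj.obj n) :
      (biprod.snd : X ⊞ D ⟶ D).hom.app n (l.hom.app n p) = i.hom.app n p := by
    rw [← comp_app_apply, biprod.lift_snd]
  have hext (n : ℤ) (z w : (X ⊞ D).obj.obj n)
      (h₁ : (biprod.fst : X ⊞ D ⟶ X).hom.app n z = (biprod.fst : X ⊞ D ⟶ X).hom.app n w)
      (h₂ : (biprod.snd : X ⊞ D ⟶ D).hom.app n z = (biprod.snd : X ⊞ D ⟶ D).hom.app n w) :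
      z = w := by
    have key (z : (X ⊞ D).obj.obj n) :
        z = (biprod.inl : X ⟶ X ⊞ D).hom.app n ((biprod.fst : X ⊞ D ⟶ X).hom.app n z) +
          (biprod.inr : D ⟶ X ⊞ D).hom.app n ((biprod.snd : X ⊞ D ⟶ D).hom.app n z) := by
      have : 𝟙 (X ⊞ D) = biprod.fst ≫ biprod.inl + biprod.snd ≫ biprod.inr := biprod.total.symm
      exact ConcreteCategory.congr_hom (congr_arg (fun φ => φ.hom.app n) this) z
    rw [key z, key w, h₁, h₂]
  obtain ⟨C, π, hπ, hπ₁, hπ₂⟩ := exists_cokernel l.hom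
  let C' : CN (ModuleCat.{u} R) N := ⟨C, isNComplex_of_surjective (X ⊞ D).property π hπ₁⟩
  have w : l ≫ (ObjectProperty.homMk π : X ⊞ D ⟶ C') = 0 := ObjectProperty.hom_ext _ hπ
  have hS : LevelwiseSplit (ShortComplex.mk l (ObjectProperty.homMk π : X ⊞ D ⟶ C') w) :=
    levelwiseSplit_of_retraction w hπ₁ hπ₂ fun n => by
      obtain ⟨r, hr⟩ := hi n
      refine ⟨r.comp ((biprod.snd : X ⊞ D ⟶ D).hom.app n).hom, fun x => ?_⟩
      exact (congr_arg r (hl₂ n x)).trans (hr x)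
  have hfst : IsIso ((KN.quotient _ N).map (biprod.fst : X ⊞ D ⟶ X)) := by
    refine ⟨(KN.quotient _ N).map biprod.inl, ?_, ?_⟩
    · rw [← Functor.map_comp, ← CategoryTheory.Functor.map_id, quotient_map_eq_iff]
      refine ⟨D, biprod.snd, -biprod.inr, isSplitInjective_disk M, isSplitProjective_disk M, ?_⟩
      rw [← biprod.total, Preadditive.comp_neg]
      abel
    · rw [← Functor.map_comp, ← CategoryTheory.Functor.map_id, biprod.inl_fst]
  refine ⟨(KN.quotient _ N).obj C', ⟨_, hS, ⟨?_⟩, ⟨Iso.refl _⟩⟩, ?_⟩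
  · refine Arrow.isoMk (f := Arrow.mk ((KN.quotient _ N).map f))
      (g := Arrow.mk ((KN.quotient _ N).map l)) (Iso.refl _)
      (asIso ((KN.quotient _ N).map (biprod.fst : X ⊞ D ⟶ X))).symm ?_
    change 𝟙 _ ≫ (KN.quotient _ N).map l = (KN.quotient _ N).map f ≫ inv _
    rw [Category.id_comp, IsIso.eq_comp_inv, ← Functor.map_comp, biprod.lift_fst]
  · rw [acyclic_quotient_iff]
    intro a b c hab hbc hc z hz
    have hinj (n : ℤ) : Function.Injective (i.hom.app n) := by
      obtain ⟨r, hr⟩ := hi n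
      exact Function.LeftInverse.injective hr
    have hfst_inr (n : ℤ) (y : D.obj.obj n) :
        (biprod.fst : X ⊞ D ⟶ X).hom.app n ((biprod.inr : D ⟶ X ⊞ D).hom.app n y) = 0 := by
      rw [← comp_app_apply, biprod.inr_fst]
      rfl
    have hsnd_inr (n : ℤ) (y : D.obj.obj n) :
        (biprod.snd : X ⊞ D ⟶ D).hom.app n ((biprod.inr : D ⟶ X ⊞ D).hom.app n y) = y := by
      rw [← comp_app_apply, biprod.inr_snd]
      rfl
    have hl₀ (n : ℤ) (p : P.obj.obj n) (hp : f.hom.app n p = 0) :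
        l.hom.app n p = (biprod.inr : D ⟶ X ⊞ D).hom.app n (i.hom.app n p) :=
      hext n _ _ (by rw [hl₁, hfst_inr, hp]) (by rw [hl₂, hsnd_inr])
    -- Surjectivity of `f` lets every class in the cokernel be represented by an element of `D`.
    obtain ⟨y, rfl⟩ : ∃ y : D.obj.obj b, z = π.app b ((biprod.inr : D ⟶ X ⊞ D).hom.app b y) := by
      obtain ⟨z, rfl⟩ := hπ₁ b z
      obtain ⟨p, hp⟩ := surjective_of_rlp f hf b ((biprod.fst : X ⊞ D ⟶ X).hom.app b z)
      refine ⟨(biprod.snd : X ⊞ D ⟶ D).hom.app b (z - l.hom.app b p), ?_⟩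
      have : (biprod.inr : D ⟶ X ⊞ D).hom.app b
          ((biprod.snd : X ⊞ D ⟶ D).hom.app b (z - l.hom.app b p)) = z - l.hom.app b p :=
        hext b _ _ (by rw [hfst_inr, map_sub, hl₁, hp, sub_self]) (hsnd_inr _ _)
      rw [this, map_sub, (hπ₂ b).apply_apply_eq_zero, sub_zero]
    rw [← seqMap_app, ← seqMap_app] at hz
    obtain ⟨p, hp⟩ := (hπ₂ c _).1 hz
    have hp₁ : f.hom.app c p = 0 := by rw [← hl₁, hp, hfst_inr]
    have hp₂ : i.hom.app c p = seqMap D.obj hbc.le y := by rw [← hl₂, hp, hsnd_inr]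
    -- The witness `p` is killed in degree `b + N`, since its image under the injective `i` is a
    -- differential of `y` and `d^N y = 0`. So `p = d q` with `f q = 0`. Replacing `y` by `y - i q`
    -- keeps its class and makes it a cycle of the acyclic disk.
    obtain ⟨q, rfl, hq⟩ := exists_seqMap_eq_of_rlp f hf hbc.le (by lia : c ≤ b + N) rfl p
      (hinj _ (by rw [seqMap_app, hp₂, seqMap_trans, seqMap_eq_zero D _ le_rfl, map_zero])) hp₁
    obtain ⟨t, ht⟩ := elemAcyclic_disk M a b c hab hbc hc (y - i.hom.app b q)
      (by rw [map_sub, ← hp₂, seqMap_app]; exact sub_self _)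
    refine ⟨π.app a ((biprod.inr : D ⟶ X ⊞ D).hom.app a t), ?_⟩
    rw [← seqMap_app, ← seqMap_app]
    erw [ht]
    rw [map_sub, map_sub, ← hl₀ _ _ hq, (hπ₂ b).apply_apply_eq_zero, sub_zero]

end Main

end NComplex

end

theorem mainTheorem9 (R : Type u) [Ring R] (N : ℕ) :
    ((NComplex.hproj (ModuleCat.{u} R) N).ι ⋙
      NComplex.DN.π (ModuleCat.{u} R) N).IsEquivalence := by
  refine NComplex.isEquivalence_ι_comp_Q _ _ NComplex.acyclicCone_le_isColocal fun X => ?_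
  obtain ⟨X, rfl⟩ := NComplex.exists_eq_quotient_obj X
  obtain ⟨P, f, hf, hP⟩ := NComplex.exists_cofibrant_resolution X
  exact ⟨_, (NComplex.KN.quotient _ N).map f, NComplex.hproj_of_llp P hP,
    NComplex.acyclicCone_of_rlp f hf⟩
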